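/- Let $D\subseteq\mathbb{R}^n$ be nonempty, closed and convex, let $Y\supseteq D$ be open, let $G:Y\to\mathbb{R}^n$ be Lipschitz continuous in a neighborhood of each point of $Y$, and let $G$ be strongly monotone on $D$ with constant $\tau>0$, i.e. $\langle G(x)-G(y),x-y\rangle\ge\tau\|x-y\|^2$ for all $x,y\in D$. Consider the variational inequality (VI): find $x^*\in D$ with $\langle G(x^*),x-x^*\rangle\ge 0$ for all $x\in D$. Fix $\alpha>0$ and, for $x\in D$, put $$\varphi_\alpha(x)=\max_{y\in D}\Big\{\langle G(x),x-y\rangle-\tfrac{\alpha}{2}\|x-y\|^2\Big\},\qquad y_\alpha(x)=\pi_D\big[x-\alpha^{-1}G(x)\big],$$ where $\pi_D$ is the Euclidean projection onto $D$. Let $\gamma>\inf_{x\in D}\varphi_\alpha(x)$, let $\beta\in(0,1)$, and let $(\tau_l)_{l\ge 0}$ be a sequence in $(0,1)$ with $\tau_l\to 0$. The method (GFPMS) runs as follows. Step 0. Choose $x^0\in D$ with $\varphi_\alpha(x^0)\le\gamma$ and $\lambda_0\in(0,\tau_0]$; set $u^0=x^0$, $k=0$, $l=0$. Step 1. Let $y^k=y_\alpha(x^k)$.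 If $y^k=x^k$, stop. Otherwise set $d^k=y^k-x^k$ and $z^{k+1}=x^k+\lambda_kd^k$. Step 2. If $\varphi_\alpha(z^{k+1})\le\varphi_\alpha(x^k)-\beta\lambda_k\|d^k\|^2$, take any $\lambda_{k+1}\in[\lambda_k,\tau_l]$, set $x^{k+1}=z^{k+1}$ and go to Step 4. Step 3. Otherwise take any $\lambda_{k+1}\in(0,\min\{\lambda_k,\tau_{l+1}\}]$ and replace $l$ by $l+1$. If $\varphi_\alpha(z^{k+1})\le\gamma$, set $x^{k+1}=z^{k+1}$ and go to Step 4. Otherwise set $x^{k+1}=u^k$, $u^{k+1}=u^k$, replace $k$ by $k+1$ and go to Step 1. Step 4. If $\varphi_\alpha(x^{k+1})<\varphi_\alpha(u^k)$, set $u^{k+1}=x^{k+1}$; otherwise set $u^{k+1}=u^k$. Replace $k$ by $k+1$ and go to Step 1. Suppose that $\beta<\tau$. Then VI has a unique solution $x^*$, and for all choices made in the method the following hold. (i) If the method stops at iteration $k$, then $x^k=x^*$. (ii) If the method does not stop, then the infinite sequence $(x^k)$ converges to $x^*$. -/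

import Mathlib

open Set Filter Topology

noncomputable section

/-- `x` solves the variational inequality: `x ∈ D` and `⟨G x, y - x⟩ ≥ 0` for all `y ∈ D`. -/
def IsVISolution {n : ℕ} (G : EuclideanSpace ℝ (Fin n) → EuclideanSpace ℝ (Fin n))
    (D : Set (EuclideanSpace ℝ (Fin n))) (x : EuclideanSpace ℝ (Fin n)) : Prop :=
  x ∈ D ∧ ∀ y ∈ D, 0 ≤ inner ℝ (G x) (y - x)

/-- Strong monotonicity of `G` on `X` with constant `τ > 0`. -/
def StronglyMonotoneOn {n : ℕ} (G : EuclideanSpace ℝ (Fin n) → EuclideanSpace ℝ (Fin n))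
    (X : Set (EuclideanSpace ℝ (Fin n))) (τ : ℝ) : Prop :=
  0 < τ ∧ ∀ x ∈ X, ∀ y ∈ X, τ * ‖x - y‖ ^ 2 ≤ inner ℝ (G x - G y) (x - y)

theorem exists_isMinOn_dist {n : ℕ} {D : Set (EuclideanSpace ℝ (Fin n))} (hne : D.Nonempty)
    (hcl : IsClosed D) (z : EuclideanSpace ℝ (Fin n)) :
    ∃ p ∈ D, ∀ q ∈ D, dist z p ≤ dist z q := by
  obtain ⟨p, hp, h⟩ := hcl.exists_infDist_eq_dist hne z
  exact ⟨p, hp, fun q hq => h ▸ Metric.infDist_le_dist_of_mem hq⟩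

open Classical in
/-- The projection of `z` onto `D`: a point of `D` nearest to `z` (it exists if `D` is nonempty and
closed, and it is unique if moreover `D` is convex; junk value `z` if there is no nearest point). -/
def projOnto {n : ℕ} (D : Set (EuclideanSpace ℝ (Fin n))) (z : EuclideanSpace ℝ (Fin n)) :
    EuclideanSpace ℝ (Fin n) :=
  if h : ∃ p ∈ D, ∀ q ∈ D, dist z p ≤ dist z q then h.choose else z

theorem projOnto_spec {n : ℕ} {D : Set (EuclideanSpace ℝ (Fin n))} (hne : D.Nonempty)
    (hcl : IsClosed D) (z : EuclideanSpace ℝ (Fin n)) :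
    projOnto D z ∈ D ∧ ∀ q ∈ D, dist z (projOnto D z) ≤ dist z q := by
  have h := exists_isMinOn_dist hne hcl z
  rw [projOnto, dif_pos h]
  exact h.choose_spec

/-- The direction mapping `x ↦ π_D[x - α⁻¹ G(x)]`. -/
def projStep {n : ℕ} (G : EuclideanSpace ℝ (Fin n) → EuclideanSpace ℝ (Fin n))
    (D : Set (EuclideanSpace ℝ (Fin n))) (α : ℝ) (x : EuclideanSpace ℝ (Fin n)) :
    EuclideanSpace ℝ (Fin n) :=
  projOnto D (x - α⁻¹ • G x)

/-- The regularized gap function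
`φ_α(x) = max_{y ∈ D} (⟨G x, x - y⟩ - (α / 2) ‖x - y‖²)`. -/
def gapFunction {n : ℕ} (G : EuclideanSpace ℝ (Fin n) → EuclideanSpace ℝ (Fin n))
    (D : Set (EuclideanSpace ℝ (Fin n))) (α : ℝ) (x : EuclideanSpace ℝ (Fin n)) : ℝ :=
  sSup ((fun y => inner ℝ (G x) (x - y) - α / 2 * ‖x - y‖ ^ 2) '' D)

/-- The supremum in the gap function is a maximum, attained at `π_D[x - α⁻¹ G(x)]`. -/
theorem gapFunction_isGreatest {n : ℕ}
    (G : EuclideanSpace ℝ (Fin n) → EuclideanSpace ℝ (Fin n))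
    {D : Set (EuclideanSpace ℝ (Fin n))} (hne : D.Nonempty) (hcl : IsClosed D)
    {α : ℝ} (hα : 0 < α) (x : EuclideanSpace ℝ (Fin n)) :
    gapFunction G D α x =
        inner ℝ (G x) (x - projStep G D α x) - α / 2 * ‖x - projStep G D α x‖ ^ 2 ∧
      IsGreatest ((fun y => inner ℝ (G x) (x - y) - α / 2 * ‖x - y‖ ^ 2) '' D)
        (gapFunction G D α x) := by
  obtain ⟨hp, hmin⟩ := projOnto_spec hne hcl (x - α⁻¹ • G x)
  have key : ∀ y, inner ℝ (G x) (x - y) - α / 2 * ‖x - y‖ ^ 2 =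
      (2 * α)⁻¹ * ‖G x‖ ^ 2 - α / 2 * dist (x - α⁻¹ • G x) y ^ 2 := by
    intro y
    have e : x - α⁻¹ • G x - y = (x - y) - α⁻¹ • G x := by abel
    rw [dist_eq_norm, e, norm_sub_sq_real (x - y) (α⁻¹ • G x), inner_smul_right, norm_smul,
      real_inner_comm, Real.norm_of_nonneg (inv_nonneg.2 hα.le)]
    field_simp
    ring
  have hg : IsGreatest ((fun y => inner ℝ (G x) (x - y) - α / 2 * ‖x - y‖ ^ 2) '' D)
      (inner ℝ (G x) (x - projStep G D α x) - α / 2 * ‖x - projStep G D α x‖ ^ 2) := by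
    refine ⟨⟨_, hp, rfl⟩, ?_⟩
    rintro _ ⟨q, hq, rfl⟩
    simp only
    rw [key, key]
    have h1 := hmin q hq
    have h2 : dist (x - α⁻¹ • G x) (projStep G D α x) ^ 2 ≤ dist (x - α⁻¹ • G x) q ^ 2 :=
      pow_le_pow_left₀ dist_nonneg h1 2
    have h3 := mul_le_mul_of_nonneg_left h2 (by positivity : 0 ≤ α / 2)
    linarith
  have he : gapFunction G D α x = _ := hg.csSup_eq
  exact ⟨he, he ▸ hg⟩

/-- The data carried by the method at iteration `k`: the iterate `x^k`, the best point found so far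
`u^k`, the step size `λ_k`, and the current index `l` in the majorant sequence. -/
@[ext]
structure SBMState (n : ℕ) where
  x : EuclideanSpace ℝ (Fin n)
  u : EuclideanSpace ℝ (Fin n)
  lam : ℝ
  l : ℕ

/-- The direction `d^k = y(x^k) - x^k`. -/
def SBMState.dir {n : ℕ} (y : EuclideanSpace ℝ (Fin n) → EuclideanSpace ℝ (Fin n))
    (s : SBMState n) : EuclideanSpace ℝ (Fin n) :=
  y s.x - s.x

/-- The trial point `z^{k+1} = x^k + λ_k d^k`. -/
def SBMState.trial {n : ℕ} (y : EuclideanSpace ℝ (Fin n) → EuclideanSpace ℝ (Fin n))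
    (s : SBMState n) : EuclideanSpace ℝ (Fin n) :=
  s.x + s.lam • s.dir y

/-- The descent test `f(z^{k+1}) ≤ f(x^k) - β λ_k ‖d^k‖²`. -/
def SBMState.Descent {n : ℕ} (f : EuclideanSpace ℝ (Fin n) → ℝ)
    (y : EuclideanSpace ℝ (Fin n) → EuclideanSpace ℝ (Fin n)) (β : ℝ) (s : SBMState n) : Prop :=
  f (s.trial y) ≤ f s.x - β * s.lam * ‖s.dir y‖ ^ 2

/-- The stopping test `y(x^k) = x^k`. -/
def SBMState.Stops {n : ℕ} (y : EuclideanSpace ℝ (Fin n) → EuclideanSpace ℝ (Fin n))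
    (s : SBMState n) : Prop :=
  y s.x = s.x

/-- Admissible initial states: `x⁰ ∈ D`, `f(x⁰) ≤ γ`, `u⁰ = x⁰`, `λ₀ ∈ (0, t₀]`, `l = 0`. -/
structure SBMInit {n : ℕ} (D : Set (EuclideanSpace ℝ (Fin n)))
    (f : EuclideanSpace ℝ (Fin n) → ℝ) (γ : ℝ) (t : ℕ → ℝ) (s : SBMState n) : Prop where
  mem : s.x ∈ D
  le_level : f s.x ≤ γ
  best : s.u = s.x
  lam_mem : s.lam ∈ Ioc 0 (t 0)
  index : s.l = 0

/-- One iteration of the method with goal function `f`, direction mapping `y`, level `γ`,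
parameter `β` and majorant sequence `t`. It is a relation since the new step size may be any point
of the prescribed interval. -/
inductive SBMStep {n : ℕ} (f : EuclideanSpace ℝ (Fin n) → ℝ)
    (y : EuclideanSpace ℝ (Fin n) → EuclideanSpace ℝ (Fin n)) (γ β : ℝ) (t : ℕ → ℝ) :
    SBMState n → SBMState n → Prop
  /-- The descent test holds: accept the trial point, do not decrease the step size. -/
  | descent (s s' : SBMState n) (continues : ¬ s.Stops y) (test : s.Descent f y β)
      (hlam : s'.lam ∈ Icc s.lam (t s.l)) (hl : s'.l = s.l)
      (hx : s'.x = s.trial y)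
      (hu : s'.u = if f s'.x < f s.u then s'.x else s.u) :
      SBMStep f y γ β t s s'
  /-- The descent test fails, but the trial point remains in the level set: move to the next
  majorant and accept the trial point. -/
  | accept (s s' : SBMState n) (continues : ¬ s.Stops y) (test : ¬ s.Descent f y β)
      (hlam : s'.lam ∈ Ioc 0 (min s.lam (t (s.l + 1)))) (hl : s'.l = s.l + 1)
      (level : f (s.trial y) ≤ γ)
      (hx : s'.x = s.trial y)
      (hu : s'.u = if f s'.x < f s.u then s'.x else s.u) :
      SBMStep f y γ β t s s'
  /-- The descent test fails and the trial point leaves the level set: move to the next majorant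
  and return to the best point found so far. -/
  | restart (s s' : SBMState n) (continues : ¬ s.Stops y) (test : ¬ s.Descent f y β)
      (hlam : s'.lam ∈ Ioc 0 (min s.lam (t (s.l + 1)))) (hl : s'.l = s.l + 1)
      (level : γ < f (s.trial y))
      (hx : s'.x = s.u) (hu : s'.u = s.u) :
      SBMStep f y γ β t s s'

/-- The states `s 0, …, s N` form a run of the method that stops at iteration `N`. -/
def SBMTerminatingRun {n : ℕ} (D : Set (EuclideanSpace ℝ (Fin n)))
    (f : EuclideanSpace ℝ (Fin n) → ℝ)
    (y : EuclideanSpace ℝ (Fin n) → EuclideanSpace ℝ (Fin n)) (γ β : ℝ) (t : ℕ → ℝ)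
    (N : ℕ) (s : ℕ → SBMState n) : Prop :=
  SBMInit D f γ t (s 0) ∧ (∀ k < N, SBMStep f y γ β t (s k) (s (k + 1))) ∧ (s N).Stops y

/-- The states `s 0, s 1, …` form a run of the method that never stops. -/
def SBMInfiniteRun {n : ℕ} (D : Set (EuclideanSpace ℝ (Fin n)))
    (f : EuclideanSpace ℝ (Fin n) → ℝ)
    (y : EuclideanSpace ℝ (Fin n) → EuclideanSpace ℝ (Fin n)) (γ β : ℝ) (t : ℕ → ℝ)
    (s : ℕ → SBMState n) : Prop :=
  SBMInit D f γ t (s 0) ∧ ∀ k, SBMStep f y γ β t (s k) (s (k + 1))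

end

/-!
Write `φ` for the regularized gap function, `y(x) = π_D[x - α⁻¹ G(x)]` and `d = y(x) - x`.
The argument avoids generalized gradients: the descent test is shown to hold *uniformly* for small
step sizes.

Let `x' = x + λ d` and `y' = y(x')`. Since `φ(x)` is a maximum, inserting the competitor `y'` bounds
`φ(x') - φ(x)` from above by an explicit expression. Its part of first order in `λ` is at most
`-τ λ ‖d‖²`, by strong monotonicity and the variational inequality of the projection; the remainder
is at most `C λ² ‖d‖²`, where `C` depends only on `α` and on a Lipschitz constant of `G` for the pair
`x, x'` (`gapFunction_add_smul_le`). Testing the maximum along the segment from `x` to a point `x₀`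
gives `φ(x) ≥ θ (⟨G x₀, x - x₀⟩ + (τ / 2) ‖x - x₀‖²)` with `θ = min 1 (τ / α)`
(`le_gapFunction_of_stronglyMonotoneOn`), so the level sets of `φ` in `D` are compact. The segments
from a level set to its image under `y` then sweep out a compact subset of `D`, on which `G` is
Lipschitz. Hence, as `β < τ`, the descent test holds on the level set for all step sizes below some
`ε > 0` (`exists_forall_descent`).

This has two consequences. A minimizer of `φ` over `D` exists, and the descent inequality forces
`d = 0` there, so it solves the variational inequality (`exists_isVISolution`). Moreover, since
`λ_k ≤ τ_l → 0`, the descent test can fail only finitely often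
(`SBMInfiniteRun.eventually_descent`), so from some iteration on `λ_k` is bounded away from `0` and
`φ(x^k)` decreases by a fixed multiple of `‖d^k‖²`. Thus `d^k → 0`
(`SBMInfiniteRun.tendsto_norm_dir`), hence
`φ(x^k) ≤ ‖G(x^k)‖ ‖d^k‖ → 0`, and the lower bound on `φ` with `x₀ = x*` gives `x^k → x*`.
-/

/-! ### Projection onto a closed convex set -/

section Projection

variable {n : ℕ} {D : Set (EuclideanSpace ℝ (Fin n))}

theorem inner_sub_projOnto_le_zero (hne : D.Nonempty) (hcl : IsClosed D) (hconv : Convex ℝ D)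
    (z : EuclideanSpace ℝ (Fin n)) {q : EuclideanSpace ℝ (Fin n)} (hq : q ∈ D) :
    inner ℝ (z - projOnto D z) (q - projOnto D z) ≤ 0 := by
  obtain ⟨hp, hmin⟩ := projOnto_spec hne hcl z
  refine (norm_eq_iInf_iff_real_inner_le_zero hconv hp).1 ?_ q hq
  have : Nonempty D := ⟨⟨_, hp⟩⟩
  refine le_antisymm (le_ciInf fun w => ?_)
    (ciInf_le (f := fun w : D => ‖z - w‖) ⟨0, ?_⟩ ⟨_, hp⟩)
  · simpa only [dist_eq_norm] using hmin w w.2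
  · rintro _ ⟨w, rfl⟩
    exact norm_nonneg _

theorem norm_projOnto_sub_projOnto_le (hne : D.Nonempty) (hcl : IsClosed D) (hconv : Convex ℝ D)
    (z w : EuclideanSpace ℝ (Fin n)) : ‖projOnto D z - projOnto D w‖ ≤ ‖z - w‖ := by
  set p := projOnto D z
  set q := projOnto D w
  have h1 : inner ℝ (z - p) (q - p) ≤ 0 :=
    inner_sub_projOnto_le_zero hne hcl hconv z (projOnto_spec hne hcl w).1
  have h2 : inner ℝ (w - q) (p - q) ≤ 0 :=
    inner_sub_projOnto_le_zero hne hcl hconv w (projOnto_spec hne hcl z).1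
  have h3 : ‖p - q‖ ^ 2 ≤ inner ℝ (z - w) (p - q) := by
    have e1 : z - w = (z - p) + (p - q) - (w - q) := by abel
    have e2 : inner ℝ (z - p) (p - q) = -inner ℝ (z - p) (q - p) := by
      rw [← inner_neg_right, neg_sub]
    rw [e1, inner_sub_left, inner_add_left, real_inner_self_eq_norm_sq, e2]
    linarith
  have h4 := real_inner_le_norm (z - w) (p - q)
  by_contra! h
  nlinarith [norm_nonneg (z - w), norm_nonneg (p - q)]

variable {G : EuclideanSpace ℝ (Fin n) → EuclideanSpace ℝ (Fin n)} {α : ℝ}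

theorem projStep_mem (hne : D.Nonempty) (hcl : IsClosed D) (x : EuclideanSpace ℝ (Fin n)) :
    projStep G D α x ∈ D :=
  (projOnto_spec hne hcl _).1

theorem inner_projStep_sub_nonneg (hne : D.Nonempty) (hcl : IsClosed D) (hconv : Convex ℝ D)
    (hα : 0 < α) (x : EuclideanSpace ℝ (Fin n)) {q : EuclideanSpace ℝ (Fin n)} (hq : q ∈ D) :
    0 ≤ inner ℝ (G x + α • (projStep G D α x - x)) (q - projStep G D α x) := by
  have h := inner_sub_projOnto_le_zero hne hcl hconv (x - α⁻¹ • G x) hq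
  have e : G x + α • (projStep G D α x - x) =
      (-α) • ((x - α⁻¹ • G x) - projOnto D (x - α⁻¹ • G x)) := by
    rw [projStep]
    simp only [neg_smul, smul_sub, smul_inv_smul₀ hα.ne']
    abel
  rw [e, inner_smul_left, projStep]
  exact mul_nonneg_of_nonpos_of_nonpos (by simpa using hα.le) h

theorem norm_projStep_sub_projStep_le (hne : D.Nonempty) (hcl : IsClosed D) (hconv : Convex ℝ D)
    (hα : 0 < α) (x x' : EuclideanSpace ℝ (Fin n)) :
    ‖projStep G D α x' - projStep G D α x‖ ≤ ‖x' - x‖ + α⁻¹ * ‖G x' - G x‖ := by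
  refine (norm_projOnto_sub_projOnto_le hne hcl hconv _ _).trans ?_
  have e : (x' - α⁻¹ • G x') - (x - α⁻¹ • G x) = (x' - x) - α⁻¹ • (G x' - G x) := by
    rw [smul_sub]
    abel
  rw [e]
  refine (norm_sub_le _ _).trans_eq ?_
  rw [norm_smul, Real.norm_of_nonneg (inv_nonneg.2 hα.le)]

theorem continuousOn_projStep (hne : D.Nonempty) (hcl : IsClosed D) (hconv : Convex ℝ D)
    (hG : ContinuousOn G D) : ContinuousOn (projStep G D α) D := by
  have h : LipschitzWith 1 (projOnto D) :=
    LipschitzWith.mk_one fun z w => by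
      simpa only [dist_eq_norm] using norm_projOnto_sub_projOnto_le hne hcl hconv z w
  have hstep : ContinuousOn (fun x => x - α⁻¹ • G x) D := by fun_prop
  exact h.continuous.comp_continuousOn hstep

theorem isVISolution_of_projStep_eq (hne : D.Nonempty) (hcl : IsClosed D) (hconv : Convex ℝ D)
    (hα : 0 < α) {x : EuclideanSpace ℝ (Fin n)} (hx : projStep G D α x = x) :
    IsVISolution G D x := by
  refine ⟨hx ▸ projStep_mem hne hcl x, fun q hq => ?_⟩
  simpa [hx] using inner_projStep_sub_nonneg (G := G) hne hcl hconv hα x hq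

theorem IsVISolution.eq_of_stronglyMonotoneOn {τ : ℝ} (hmono : StronglyMonotoneOn G D τ)
    {x y : EuclideanSpace ℝ (Fin n)} (hx : IsVISolution G D x) (hy : IsVISolution G D y) :
    x = y := by
  obtain ⟨hτ, hm⟩ := hmono
  have h := hm x hx.1 y hy.1
  have h1 := hx.2 y hy.1
  have h2 := hy.2 x hx.1
  rw [← neg_sub x y, inner_neg_right] at h1
  rw [inner_sub_left] at h
  have h3 : ‖x - y‖ ^ 2 ≤ 0 := by nlinarith
  exact sub_eq_zero.1 (norm_eq_zero.1 (pow_eq_zero_iff two_ne_zero |>.1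
    (le_antisymm h3 (sq_nonneg _))))

end Projection

/-! ### Bounds on the regularized gap function -/

section Gap

variable {n : ℕ} {D : Set (EuclideanSpace ℝ (Fin n))}
  {G : EuclideanSpace ℝ (Fin n) → EuclideanSpace ℝ (Fin n)} {α τ : ℝ}

theorem le_gapFunction (hne : D.Nonempty) (hcl : IsClosed D) (hα : 0 < α)
    (x : EuclideanSpace ℝ (Fin n)) {y : EuclideanSpace ℝ (Fin n)} (hy : y ∈ D) :
    inner ℝ (G x) (x - y) - α / 2 * ‖x - y‖ ^ 2 ≤ gapFunction G D α x :=
  (gapFunction_isGreatest G hne hcl hα x).2.2 ⟨y, hy, rfl⟩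

theorem gapFunction_nonneg (hne : D.Nonempty) (hcl : IsClosed D) (hα : 0 < α)
    {x : EuclideanSpace ℝ (Fin n)} (hx : x ∈ D) : 0 ≤ gapFunction G D α x := by
  simpa using le_gapFunction (G := G) hne hcl hα x hx

theorem gapFunction_le_norm_mul_norm (hne : D.Nonempty) (hcl : IsClosed D) (hα : 0 < α)
    (x : EuclideanSpace ℝ (Fin n)) :
    gapFunction G D α x ≤ ‖G x‖ * ‖projStep G D α x - x‖ := by
  rw [(gapFunction_isGreatest G hne hcl hα x).1, norm_sub_rev (projStep G D α x)]
  have h := real_inner_le_norm (G x) (x - projStep G D α x)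
  have : 0 ≤ α / 2 * ‖x - projStep G D α x‖ ^ 2 := by positivity
  linarith

theorem continuousOn_gapFunction (hne : D.Nonempty) (hcl : IsClosed D) (hconv : Convex ℝ D)
    (hα : 0 < α) (hG : ContinuousOn G D) : ContinuousOn (gapFunction G D α) D := by
  have hy := continuousOn_projStep (α := α) hne hcl hconv hG
  have hd : ContinuousOn (fun x => x - projStep G D α x) D := continuousOn_id.sub hy
  refine ((hG.inner (𝕜 := ℝ) hd).sub ((hd.norm.pow 2).const_mul (α / 2))).congr fun x _ => ?_
  exact (gapFunction_isGreatest G hne hcl hα x).1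

/-- Growth of the gap function away from any point `x₀` of `D`. At the solution `x₀` of the
variational inequality the inner product is nonnegative, so this is then an error bound. -/
theorem le_gapFunction_of_stronglyMonotoneOn (hne : D.Nonempty) (hcl : IsClosed D)
    (hconv : Convex ℝ D) (hα : 0 < α) (hmono : StronglyMonotoneOn G D τ)
    {x₀ x : EuclideanSpace ℝ (Fin n)} (hx₀ : x₀ ∈ D) (hx : x ∈ D) :
    min 1 (τ / α) * (inner ℝ (G x₀) (x - x₀) + τ / 2 * ‖x - x₀‖ ^ 2) ≤ gapFunction G D α x := by
  obtain ⟨hτ, hm⟩ := hmono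
  set θ := min 1 (τ / α)
  have hθ0 : 0 < θ := lt_min one_pos (div_pos hτ hα)
  have hθ1 : θ ≤ 1 := min_le_left _ _
  -- `θ` is small enough for half of the strong monotonicity to absorb the quadratic penalty.
  have hθα : θ * α ≤ τ := (le_div_iff₀ hα).1 (min_le_right _ _)
  have hy : x + θ • (x₀ - x) ∈ D := hconv.add_smul_sub_mem hx hx₀ ⟨hθ0.le, hθ1⟩
  have h := le_gapFunction (G := G) hne hcl hα x hy
  have e : x - (x + θ • (x₀ - x)) = θ • (x - x₀) := by
    rw [sub_add_cancel_left, ← smul_neg, neg_sub]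
  rw [e, inner_smul_right, norm_smul, Real.norm_of_nonneg hθ0.le, mul_pow] at h
  have h1 := hm x hx x₀ hx₀
  rw [inner_sub_left] at h1
  have h2 : 0 ≤ θ * (τ - θ * α) * ‖x - x₀‖ ^ 2 := by
    have := sub_nonneg.2 hθα
    positivity
  nlinarith [mul_le_mul_of_nonneg_left h1 hθ0.le]

theorem isBounded_gapFunction_le (hne : D.Nonempty) (hcl : IsClosed D)
    (hconv : Convex ℝ D) (hα : 0 < α) (hmono : StronglyMonotoneOn G D τ) (γ : ℝ) :
    Bornology.IsBounded {x ∈ D | gapFunction G D α x ≤ γ} := by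
  obtain ⟨x₀, hx₀⟩ := hne
  have hθ0 : 0 < min 1 (τ / α) := lt_min one_pos (div_pos hmono.1 hα)
  set θ := min 1 (τ / α) with hθ
  refine (Metric.isBounded_iff_subset_closedBall x₀).2
    ⟨max 1 ((|γ| / θ + ‖G x₀‖) / (τ / 2)), fun x ⟨hx, hxγ⟩ => ?_⟩
  rw [Metric.mem_closedBall, dist_eq_norm]
  rcases le_total ‖x - x₀‖ 1 with h1 | h1
  · exact h1.trans (le_max_left _ _)
  refine le_max_of_le_right ((le_div_iff₀ (half_pos hmono.1)).2 ?_)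
  have h := (le_gapFunction_of_stronglyMonotoneOn ⟨x₀, hx₀⟩ hcl hconv hα hmono hx₀ hx).trans
    (hxγ.trans (le_abs_self γ))
  rw [← hθ, mul_comm, ← le_div_iff₀ hθ0] at h
  have h2 := (abs_le.1 (abs_real_inner_le_norm (G x₀) (x - x₀))).1
  have h3 : 0 ≤ |γ| / θ := by positivity
  by_contra! h4
  nlinarith

theorem isCompact_gapFunction_le (hne : D.Nonempty) (hcl : IsClosed D)
    (hconv : Convex ℝ D) (hα : 0 < α) (hG : ContinuousOn G D) (hmono : StronglyMonotoneOn G D τ)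
    (γ : ℝ) : IsCompact {x ∈ D | gapFunction G D α x ≤ γ} :=
  Metric.isCompact_of_isClosed_isBounded
    ((continuousOn_gapFunction hne hcl hconv hα hG).preimage_isClosed_of_isClosed hcl isClosed_Iic)
    (isBounded_gapFunction_le hne hcl hconv hα hmono γ)

end Gap

/-! ### Uniform descent along the direction mapping -/

section Descent

variable {n : ℕ} {D : Set (EuclideanSpace ℝ (Fin n))}
  {G : EuclideanSpace ℝ (Fin n) → EuclideanSpace ℝ (Fin n)} {α τ β : ℝ}

/-- Descent estimate along `d = y(x) - x`, with an error of second order in the step size. Only the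
Lipschitz bound of `G` between the two ends of the step enters. -/
theorem gapFunction_add_smul_le (hne : D.Nonempty) (hcl : IsClosed D) (hconv : Convex ℝ D)
    (hα : 0 < α) (hmono : StronglyMonotoneOn G D τ) {L lam : ℝ} (hL : 0 ≤ L) (hlam : 0 < lam)
    (hlam1 : lam ≤ 1) {x d : EuclideanSpace ℝ (Fin n)} (hx : x ∈ D)
    (hd : d = projStep G D α x - x) (hGL : ‖G (x + lam • d) - G x‖ ≤ L * (lam * ‖d‖)) :
    gapFunction G D α (x + lam • d) ≤ gapFunction G D α x -
      (τ - lam * (L + (L + α) * (1 + α⁻¹ * L))) * lam * ‖d‖ ^ 2 := by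
  have hyD : projStep G D α x ∈ D := projStep_mem hne hcl x
  have hx'D : x + lam • d ∈ D := hd ▸ hconv.add_smul_sub_mem hx hyD ⟨hlam.le, hlam1⟩
  set e := projStep G D α (x + lam • d) - projStep G D α x with he
  set h := G (x + lam • d) - G x with hh
  set κ := 1 + α⁻¹ * L with hκ
  have hκ0 : 0 ≤ κ := by positivity
  -- `y(x') = x + d + e` is inserted into the maximum defining the gap function at `x`.
  have hy' : projStep G D α (x + lam • d) = x + d + e := by rw [he, hd]; abel
  have hG' : G (x + lam • d) = G x + h := by rw [hh]; abel
  have hxlow := le_gapFunction (G := G) hne hcl hα x (projStep_mem (G := G) (α := α) hne hcl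
    (x + lam • d))
  have hx'eq := (gapFunction_isGreatest G hne hcl hα (x + lam • d)).1
  have e1 : x - (x + d + e) = -(d + e) := by abel
  have e2 : x + lam • d - (x + d + e) = lam • d - (d + e) := by abel
  rw [hy', e1, norm_neg, inner_neg_right, inner_add_right] at hxlow
  rw [hy', e2, hG', norm_sub_sq_real, inner_add_left, inner_sub_right, inner_sub_right,
    inner_add_right, inner_add_right, inner_add_right] at hx'eq
  simp only [inner_smul_left, inner_smul_right, norm_smul, Real.norm_of_nonneg hlam.le,
    real_inner_self_eq_norm_sq, conj_trivial] at hx'eq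
  -- The variational inequality of the projection, tested at `x`.
  have hproj : inner ℝ (G x) d + α * ‖d‖ ^ 2 ≤ 0 := by
    have := inner_projStep_sub_nonneg (G := G) hne hcl hconv hα x hx
    rw [← neg_sub (projStep G D α x) x, ← hd, inner_neg_right, inner_add_left, inner_smul_left,
      real_inner_self_eq_norm_sq, conj_trivial] at this
    linarith
  have hm : τ * lam * ‖d‖ ^ 2 ≤ inner ℝ h d := by
    have := hmono.2 _ hx'D _ hx
    rw [add_sub_cancel_left, ← hh, norm_smul, Real.norm_of_nonneg hlam.le, inner_smul_right] at this
    refine le_of_mul_le_mul_left ?_ hlam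
    linarith
  have hen : ‖e‖ ≤ κ * (lam * ‖d‖) := by
    refine (norm_projStep_sub_projStep_le hne hcl hconv hα x (x + lam • d)).trans ?_
    rw [add_sub_cancel_left, norm_smul, Real.norm_of_nonneg hlam.le, ← hh]
    have := mul_le_mul_of_nonneg_left hGL (inv_nonneg.2 hα.le)
    rw [hκ]
    linarith
  have hhd : inner ℝ h d ≤ L * (lam * ‖d‖) * ‖d‖ :=
    (real_inner_le_norm h d).trans (mul_le_mul_of_nonneg_right hGL (norm_nonneg d))
  have hhe : -inner ℝ h e ≤ L * (lam * ‖d‖) * (κ * (lam * ‖d‖)) := by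
    rw [← inner_neg_right]
    refine (real_inner_le_norm h (-e)).trans ?_
    rw [norm_neg]
    exact mul_le_mul hGL hen (norm_nonneg e) (by positivity)
  have hde : inner ℝ d e ≤ ‖d‖ * (κ * (lam * ‖d‖)) :=
    (real_inner_le_norm d e).trans (mul_le_mul_of_nonneg_left hen (norm_nonneg d))
  have h1 := mul_le_mul_of_nonneg_left hproj hlam.le
  have h2 := mul_le_mul_of_nonneg_left hhd hlam.le
  have h3 := mul_le_mul_of_nonneg_left hde (mul_pos hα hlam).le
  have h4 : 0 ≤ α / 2 * (lam * ‖d‖) ^ 2 := by positivity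
  linarith

/-- On a level set of the gap function the descent test holds for all small step sizes, with one
threshold for the whole level set. -/
theorem exists_forall_descent (hne : D.Nonempty) (hcl : IsClosed D) (hconv : Convex ℝ D)
    (hG : LocallyLipschitzOn D G) (hmono : StronglyMonotoneOn G D τ) (hα : 0 < α) (hβτ : β < τ)
    (γ : ℝ) :
    ∃ ε > 0, ∀ s : SBMState n, s.x ∈ D → gapFunction G D α s.x ≤ γ → 0 < s.lam → s.lam ≤ ε →
      s.Descent (gapFunction G D α) (projStep G D α) β := by
  set S := {x ∈ D | gapFunction G D α x ≤ γ}
  have hScomp : IsCompact S := isCompact_gapFunction_le hne hcl hconv hα hG.continuousOn hmono γ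
  have hSD : S ⊆ D := fun x hx => hx.1
  -- The union of the segments from the points of the level set to their images.
  set T := (fun p : EuclideanSpace ℝ (Fin n) × ℝ => p.1 + p.2 • (projStep G D α p.1 - p.1)) ''
    (S ×ˢ Icc (0 : ℝ) 1)
  have hTD : T ⊆ D := by
    rintro _ ⟨⟨x, r⟩, ⟨hx, hr⟩, rfl⟩
    exact hconv.add_smul_sub_mem (hSD hx) (projStep_mem hne hcl x) hr
  have hTcomp : IsCompact T := by
    refine (hScomp.prod isCompact_Icc).image_of_continuousOn ?_
    have hy : ContinuousOn (fun p : EuclideanSpace ℝ (Fin n) × ℝ => projStep G D α p.1)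
        (S ×ˢ Icc (0 : ℝ) 1) :=
      ((continuousOn_projStep hne hcl hconv hG.continuousOn).mono hSD).comp continuousOn_fst
        fun p hp => hp.1
    exact continuousOn_fst.add (continuousOn_snd.smul (hy.sub continuousOn_fst))
  obtain ⟨L, hL⟩ := (hG.mono hTD).exists_lipschitzOnWith_of_compact hTcomp
  have hC : 0 < (L : ℝ) + (L + α) * (1 + α⁻¹ * L) := by positivity
  refine ⟨min 1 ((τ - β) / (L + (L + α) * (1 + α⁻¹ * L))),
    lt_min one_pos (div_pos (sub_pos.2 hβτ) hC), fun s hx hγ hlam hle => ?_⟩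
  have hlam1 : s.lam ≤ 1 := hle.trans (min_le_left _ _)
  have hlamC := (le_div_iff₀ hC).1 (hle.trans (min_le_right _ _))
  have hxT : s.x ∈ T := ⟨(s.x, 0), ⟨⟨hx, hγ⟩, by simp⟩, by simp⟩
  have hx'T : s.x + s.lam • s.dir (projStep G D α) ∈ T :=
    ⟨(s.x, s.lam), ⟨⟨hx, hγ⟩, hlam.le, hlam1⟩, rfl⟩
  have hGL := hL.dist_le_mul _ hx'T _ hxT
  rw [dist_eq_norm, dist_eq_norm, add_sub_cancel_left, norm_smul,
    Real.norm_of_nonneg hlam.le] at hGL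
  have h := gapFunction_add_smul_le hne hcl hconv hα hmono L.coe_nonneg hlam hlam1 hx rfl hGL
  exact h.trans (sub_le_sub_left (mul_le_mul_of_nonneg_right
    (mul_le_mul_of_nonneg_right (le_sub_comm.1 hlamC) hlam.le) (sq_nonneg _)) _)

theorem exists_isVISolution (hne : D.Nonempty) (hcl : IsClosed D) (hconv : Convex ℝ D)
    (hG : LocallyLipschitzOn D G) (hmono : StronglyMonotoneOn G D τ) (hα : 0 < α) :
    ∃ x, IsVISolution G D x := by
  obtain ⟨x₀, hx₀⟩ := id hne
  have hcont := continuousOn_gapFunction hne hcl hconv hα hG.continuousOn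
  obtain ⟨x, ⟨hx, hxγ⟩, hmin⟩ :=
    (isCompact_gapFunction_le hne hcl hconv hα hG.continuousOn hmono
      (gapFunction G D α x₀)).exists_isMinOn ⟨x₀, hx₀, le_rfl⟩ (hcont.mono fun x hx => hx.1)
  refine ⟨x, isVISolution_of_projStep_eq hne hcl hconv hα (sub_eq_zero.1 ?_)⟩
  have hτ2 : 0 < τ / 2 := half_pos hmono.1
  obtain ⟨ε, hε, hdesc⟩ := exists_forall_descent hne hcl hconv hG hmono hα
    (half_lt_self hmono.1) (gapFunction G D α x₀)
  set s : SBMState n := ⟨x, x, min 1 ε, 0⟩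
  have hlam : 0 < min 1 ε := lt_min one_pos hε
  have h : gapFunction G D α (s.trial (projStep G D α)) ≤ gapFunction G D α x -
      τ / 2 * min 1 ε * ‖projStep G D α x - x‖ ^ 2 := hdesc s hx hxγ hlam (min_le_right _ _)
  have hnn : 0 ≤ τ / 2 * min 1 ε * ‖projStep G D α x - x‖ ^ 2 := by positivity
  have htrial : s.trial (projStep G D α) ∈ D :=
    hconv.add_smul_sub_mem hx (projStep_mem hne hcl x) ⟨hlam.le, min_le_left _ _⟩
  have h1 : gapFunction G D α x ≤ gapFunction G D α (s.trial (projStep G D α)) :=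
    hmin ⟨htrial, by linarith⟩
  have h2 : τ / 2 * min 1 ε * ‖projStep G D α x - x‖ ^ 2 = 0 := by linarith
  simpa [hτ2.ne', hlam.ne', hmono.1.ne'] using h2

end Descent

/-! ### Runs of the method -/

section Runs

variable {n : ℕ} {D : Set (EuclideanSpace ℝ (Fin n))} {f : EuclideanSpace ℝ (Fin n) → ℝ}
  {y : EuclideanSpace ℝ (Fin n) → EuclideanSpace ℝ (Fin n)} {γ β : ℝ} {t : ℕ → ℝ}

/-- The invariant of the method: the iterate and the best point found so far are points of `D` in
the level set of `γ`, and the step size is positive and at most the current majorant. -/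
structure SBMState.Admissible (D : Set (EuclideanSpace ℝ (Fin n)))
    (f : EuclideanSpace ℝ (Fin n) → ℝ) (γ : ℝ) (t : ℕ → ℝ) (s : SBMState n) : Prop where
  x_mem : s.x ∈ D
  x_level : f s.x ≤ γ
  u_mem : s.u ∈ D
  u_level : f s.u ≤ γ
  lam_pos : 0 < s.lam
  lam_le : s.lam ≤ t s.l

theorem SBMInit.admissible {s : SBMState n} (h : SBMInit D f γ t s) : s.Admissible D f γ t where
  x_mem := h.mem
  x_level := h.le_level
  u_mem := h.best ▸ h.mem
  u_level := h.best ▸ h.le_level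
  lam_pos := h.lam_mem.1
  lam_le := h.index ▸ h.lam_mem.2

theorem SBMStep.admissible (hconv : Convex ℝ D) (hy : ∀ x ∈ D, y x ∈ D) (hβ : 0 ≤ β)
    (ht : ∀ l, t l ≤ 1) {s s' : SBMState n} (hstep : SBMStep f y γ β t s s')
    (hs : s.Admissible D f γ t) : s'.Admissible D f γ t := by
  have htrial : s.trial y ∈ D :=
    hconv.add_smul_sub_mem hs.x_mem (hy _ hs.x_mem) ⟨hs.lam_pos.le, hs.lam_le.trans (ht _)⟩
  -- The new best point is the new iterate or the old best point.
  have best : ∀ {v : EuclideanSpace ℝ (Fin n)}, v ∈ D → f v ≤ γ →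
      s'.u = (if f v < f s.u then v else s.u) → s'.u ∈ D ∧ f s'.u ≤ γ := by
    intro v hv hvγ hu
    rw [hu]
    split_ifs
    exacts [⟨hv, hvγ⟩, ⟨hs.u_mem, hs.u_level⟩]
  cases hstep with
  | descent _ test hlam hl hx hu =>
    have hlev : f s'.x ≤ γ := by
      have : 0 ≤ β * s.lam * ‖s.dir y‖ ^ 2 :=
        mul_nonneg (mul_nonneg hβ hs.lam_pos.le) (sq_nonneg _)
      have h := hs.x_level
      rw [SBMState.Descent, ← hx] at test
      linarith
    obtain ⟨h1, h2⟩ := best (hx ▸ htrial) hlev hu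
    exact ⟨hx ▸ htrial, hlev, h1, h2, hs.lam_pos.trans_le hlam.1, hl ▸ hlam.2⟩
  | accept _ test hlam hl level hx hu =>
    obtain ⟨h1, h2⟩ := best (hx ▸ htrial) (hx ▸ level) hu
    exact ⟨hx ▸ htrial, hx ▸ level, h1, h2, hlam.1, hl ▸ hlam.2.trans (min_le_right _ _)⟩
  | restart _ test hlam hl level hx hu =>
    exact ⟨hx ▸ hs.u_mem, hx ▸ hs.u_level, hu ▸ hs.u_mem, hu ▸ hs.u_level, hlam.1,
      hl ▸ hlam.2.trans (min_le_right _ _)⟩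

theorem SBMStep.of_descent {s s' : SBMState n} (hstep : SBMStep f y γ β t s s')
    (h : s.Descent f y β) : s'.x = s.trial y ∧ s.lam ≤ s'.lam ∧ s'.l = s.l := by
  cases hstep with
  | descent _ _ hlam hl hx _ => exact ⟨hx, hlam.1, hl⟩
  | accept _ test => exact absurd h test
  | restart _ test => exact absurd h test

theorem SBMStep.of_not_descent {s s' : SBMState n} (hstep : SBMStep f y γ β t s s')
    (h : ¬ s.Descent f y β) : s'.l = s.l + 1 := by
  cases hstep with
  | descent _ test => exact absurd test h
  | accept _ _ _ hl => exact hl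
  | restart _ _ _ hl => exact hl

theorem SBMInfiniteRun.admissible (hconv : Convex ℝ D) (hy : ∀ x ∈ D, y x ∈ D) (hβ : 0 ≤ β)
    (ht : ∀ l, t l ≤ 1) {s : ℕ → SBMState n} (hs : SBMInfiniteRun D f y γ β t s) (k : ℕ) :
    (s k).Admissible D f γ t := by
  induction k with
  | zero => exact hs.1.admissible
  | succ k ih => exact (hs.2 k).admissible hconv hy hβ ht ih

/-- If the descent test cannot fail for small step sizes, it fails only finitely often: each failure
advances the index of the majorant, and the majorants tend to zero. -/
theorem SBMInfiniteRun.eventually_descent {s : ℕ → SBMState n}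
    (hs : SBMInfiniteRun D f y γ β t s) (hadm : ∀ k, (s k).Admissible D f γ t)
    (htlim : Tendsto t atTop (𝓝 0)) {ε : ℝ} (hε : 0 < ε)
    (hdesc : ∀ k, (s k).lam ≤ ε → (s k).Descent f y β) :
    ∃ K, ∀ k ≥ K, (s k).Descent f y β := by
  obtain ⟨M, hM⟩ := eventually_atTop.1 (htlim.eventually (Iic_mem_nhds hε))
  have hbound : ∀ k, (s k).l ≤ M := by
    intro k
    induction k with
    | zero => exact hs.1.index.trans_le (Nat.zero_le M)
    | succ k ih =>
      by_cases h : (s k).Descent f y β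
      · exact ((hs.2 k).of_descent h).2.2.trans_le ih
      · rw [(hs.2 k).of_not_descent h]
        by_contra! hlt
        exact h (hdesc k ((hadm k).lam_le.trans (hM _ (by omega))))
  have hmono : Monotone fun k => (s k).l := by
    refine monotone_nat_of_le_succ fun k => ?_
    by_cases h : (s k).Descent f y β
    · exact ((hs.2 k).of_descent h).2.2.ge
    · rw [(hs.2 k).of_not_descent h]
      exact Nat.le_succ _
  -- The index attains its maximum, and stays there.
  obtain ⟨K, hK⟩ : ∃ K, ∀ k, (s k).l ≤ (s K).l := by
    have hfin : (range fun k => (s k).l).Finite :=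
      (finite_Iic M).subset (range_subset_iff.2 hbound)
    obtain ⟨_, ⟨K, rfl⟩, hK⟩ := exists_max_image _ id hfin (range_nonempty _)
    exact ⟨K, fun k => hK _ ⟨k, rfl⟩⟩
  refine ⟨K, fun k hk => ?_⟩
  by_contra h
  have h1 := (hs.2 k).of_not_descent h
  have h2 := hK (k + 1)
  have h3 : (s K).l ≤ (s k).l := hmono hk
  omega

/-- Once the descent test always holds, the step sizes no longer decrease and the values of a
goal function that is bounded below converge, so the directions tend to zero. -/
theorem SBMInfiniteRun.tendsto_norm_dir {s : ℕ → SBMState n}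
    (hs : SBMInfiniteRun D f y γ β t s) (hadm : ∀ k, (s k).Admissible D f γ t) (hβ : 0 < β)
    (hf : ∀ x ∈ D, 0 ≤ f x) (hdesc : ∃ K, ∀ k ≥ K, (s k).Descent f y β) :
    Tendsto (fun k => ‖(s k).dir y‖) atTop (𝓝 0) := by
  obtain ⟨K, hK⟩ := hdesc
  have hlam : ∀ k, (s K).lam ≤ (s (k + K)).lam := by
    intro k
    induction k with
    | zero => simp
    | succ k ih =>
      rw [Nat.add_right_comm]
      exact ih.trans ((hs.2 _).of_descent (hK (k + K) (Nat.le_add_left K k))).2.1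
  have hc : 0 < β * (s K).lam := mul_pos hβ (hadm K).lam_pos
  have hdecr : ∀ k, β * (s K).lam * ‖(s (k + K)).dir y‖ ^ 2 ≤
      f (s (k + K)).x - f (s (k + 1 + K)).x := by
    intro k
    have h := hK (k + K) (Nat.le_add_left K k)
    have hx := ((hs.2 _).of_descent h).1
    rw [SBMState.Descent, ← hx, Nat.add_right_comm] at h
    have : β * (s K).lam * ‖(s (k + K)).dir y‖ ^ 2 ≤
        β * (s (k + K)).lam * ‖(s (k + K)).dir y‖ ^ 2 := by
      gcongr
      exact hlam k
    linarith
  have hanti : Antitone fun k => f (s (k + K)).x := by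
    refine antitone_nat_of_succ_le fun k => sub_nonneg.1 (le_trans ?_ (hdecr k))
    positivity
  have hlim := tendsto_atTop_ciInf hanti ⟨0, by
    rintro _ ⟨k, rfl⟩
    exact hf _ (hadm _).x_mem⟩
  have hdiff := hlim.sub (hlim.comp (tendsto_add_atTop_nat 1))
  rw [sub_self] at hdiff
  have hsq : Tendsto (fun k => ‖(s (k + K)).dir y‖ ^ 2) atTop (𝓝 0) := by
    refine squeeze_zero (fun k => sq_nonneg _) (fun k => ?_)
      (by simpa only [mul_zero] using hdiff.const_mul (β * (s K).lam)⁻¹)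
    rw [inv_mul_eq_div, le_div_iff₀ hc, mul_comm]
    exact hdecr k
  refine (tendsto_add_atTop_iff_nat K).1 ?_
  simpa using hsq.sqrt

end Runs

/-! ### Convergence -/

theorem theorem5p1 {n : ℕ} (D Y : Set (EuclideanSpace ℝ (Fin n)))
    (G : EuclideanSpace ℝ (Fin n) → EuclideanSpace ℝ (Fin n)) (α τ β γ : ℝ) (t : ℕ → ℝ)
    (hDne : D.Nonempty) (hDclosed : IsClosed D) (hDconvex : Convex ℝ D)
    (hYopen : IsOpen Y) (hDY : D ⊆ Y) (hG : LocallyLipschitzOn Y G)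
    (hmono : StronglyMonotoneOn G D τ)
    (hα : 0 < α) (hβ : β ∈ Ioo (0 : ℝ) 1) (hβτ : β < τ)
    (hγ : sInf (gapFunction G D α '' D) < γ)
    (ht : ∀ l, t l ∈ Ioo (0 : ℝ) 1) (htlim : Tendsto t atTop (𝓝 0)) :
    ∃ xstar : EuclideanSpace ℝ (Fin n),
      IsVISolution G D xstar ∧ (∀ x, IsVISolution G D x → x = xstar) ∧
      (∀ (N : ℕ) (s : ℕ → SBMState n),
        SBMTerminatingRun D (gapFunction G D α) (projStep G D α) γ β t N s →
          (s N).x = xstar) ∧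
      (∀ s : ℕ → SBMState n,
        SBMInfiniteRun D (gapFunction G D α) (projStep G D α) γ β t s →
          Tendsto (fun k => (s k).x) atTop (𝓝 xstar)) := by
  have hGD : LocallyLipschitzOn D G := hG.mono hDY
  obtain ⟨xstar, hxs⟩ := exists_isVISolution hDne hDclosed hDconvex hGD hmono hα
  have huniq : ∀ x, IsVISolution G D x → x = xstar := fun x hx =>
    hx.eq_of_stronglyMonotoneOn hmono hxs
  refine ⟨xstar, hxs, huniq, fun N s hs => huniq _
    (isVISolution_of_projStep_eq hDne hDclosed hDconvex hα hs.2.2), fun s hs => ?_⟩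
  have hadm := hs.admissible hDconvex (fun x _ => projStep_mem hDne hDclosed x) hβ.1.le
    fun l => (ht l).2.le
  obtain ⟨ε, hε, hdesc⟩ := exists_forall_descent hDne hDclosed hDconvex hGD hmono hα hβτ γ
  have hdir := hs.tendsto_norm_dir hadm hβ.1
    (fun x hx => gapFunction_nonneg hDne hDclosed hα hx)
    (hs.eventually_descent hadm htlim hε fun k hk =>
      hdesc (s k) (hadm k).x_mem (hadm k).x_level (hadm k).lam_pos hk)
  obtain ⟨M, hM⟩ := (isCompact_gapFunction_le hDne hDclosed hDconvex hα hGD.continuousOn hmono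
    γ).exists_bound_of_continuousOn (hGD.continuousOn.mono fun x hx => hx.1)
  have hc : 0 < min 1 (τ / α) * (τ / 2) :=
    mul_pos (lt_min one_pos (div_pos hmono.1 hα)) (half_pos hmono.1)
  have hsq : Tendsto (fun k => ‖(s k).x - xstar‖ ^ 2) atTop (𝓝 0) := by
    refine squeeze_zero (fun k => sq_nonneg _) (fun k => ?_)
      (by simpa only [mul_zero] using hdir.const_mul ((min 1 (τ / α) * (τ / 2))⁻¹ * M))
    have hx := (hadm k).x_mem
    have h1 := le_gapFunction_of_stronglyMonotoneOn hDne hDclosed hDconvex hα hmono hxs.1 hx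
    have h2 : gapFunction G D α (s k).x ≤ M * ‖(s k).dir (projStep G D α)‖ :=
      (gapFunction_le_norm_mul_norm hDne hDclosed hα _).trans
        (mul_le_mul_of_nonneg_right (hM _ ⟨hx, (hadm k).x_level⟩) (norm_nonneg _))
    have h3 : 0 ≤ min 1 (τ / α) * inner ℝ (G xstar) ((s k).x - xstar) :=
      mul_nonneg (le_min zero_le_one (div_pos hmono.1 hα).le) (hxs.2 _ hx)
    rw [mul_assoc, inv_mul_eq_div, le_div_iff₀ hc]
    linarith
  rw [tendsto_iff_norm_sub_tendsto_zero]
  simpa using hsq.sqrt
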